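/- Let $\Omega=\{(a,b)\in\mathbb{R}^2 : a,b\in(0,1],\ a+b>1\}$ (the BCZ, or Farey, triangle). For $(a,b)\in\Omega$ put $k(a,b)=\left\lfloor\frac{1+a}{b}\right\rfloor$, and let $T:\Omega\to\Omega$, $T(a,b)=(b,\,-a+k(a,b)\,b)$, be the BCZ map, which is a bijection of $\Omega$. For $n\in\mathbb{Z}$ put $k_n(a,b)=k\left(T^{n-1}(a,b)\right)$, and for $n\ge 1$ put $$f_n=\sum_{i=1}^{n}\left(k_i(a,b)-3\right),\qquad f_{-n}=\sum_{i=0}^{n}\left(k_{-i}(a,b)-3\right).$$ For an irrational number $s$, its Diophantine exponent $e(s)$, even Diophantine exponent $e^+(s)$ and odd Diophantine exponent $e^-(s)$ are the suprema in $[-\infty,+\infty]$ of the sets of those $v\in\mathbb{R}$ for which, respectively, $$\left|s-\tfrac pq\right|<\tfrac1{q^v},\qquad 0<\tfrac pq-s<\tfrac1{q^v},\qquad 0<s-\tfrac pq<\tfrac1{q^v}$$ has infinitely many solutions $\frac pq\in\mathbb{Q}$ (in lowest terms, $q>0$). Then for almost every $(a,b)\in\Omega$ with respect to Lebesgue measure,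 $s=\frac ba$ is irrational, $e(s)=e^+(s)=e^-(s)=2$, and $$\limsup_{n\to+\infty}\frac{\log|f_n|}{\log n}=\limsup_{n\to+\infty}\frac{\log|f_{-n}|}{\log n}=\frac12 .$$ -/

import Mathlib

open Filter MeasureTheory

noncomputable section

namespace BCZ

/-- The Farey (or BCZ) triangle `{(a, b) : a, b ∈ (0, 1], a + b > 1}`. -/
def triangle : Set (ℝ × ℝ) :=
  {x | 0 < x.1 ∧ x.1 ≤ 1 ∧ 0 < x.2 ∧ x.2 ≤ 1 ∧ 1 < x.1 + x.2}

/-- The itinerary (or index) function `k(a, b) = [(1 + a) / b]`. -/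
def index (x : ℝ × ℝ) : ℤ := ⌊(1 + x.1) / x.2⌋

/-- The formula `(a, b) ↦ (b, -a + k(a, b) b)`. -/
def mapFormula (x : ℝ × ℝ) : ℝ × ℝ := (x.2, -x.1 + (index x : ℝ) * x.2)

/-- The formula `(a, b) ↦ (-b + k(b, a) a, a)` of the inverse. -/
def invFormula (x : ℝ × ℝ) : ℝ × ℝ := (-x.2 + (index x.swap : ℝ) * x.1, x.1)

theorem mapFormula_mem {x : ℝ × ℝ} (hx : x ∈ triangle) : mapFormula x ∈ triangle := by
  obtain ⟨h1, h2, h3, h4, h5⟩ := hx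
  have hl : (index x : ℝ) * x.2 ≤ 1 + x.1 :=
    (le_div_iff₀ h3).1 (Int.floor_le ((1 + x.1) / x.2))
  have hu : 1 + x.1 < ((index x : ℝ) + 1) * x.2 :=
    (div_lt_iff₀ h3).1 (Int.lt_floor_add_one ((1 + x.1) / x.2))
  refine ⟨h3, h4, ?_, ?_, ?_⟩ <;> simp only [mapFormula] <;> linarith

theorem invFormula_eq_swap (x : ℝ × ℝ) : invFormula x = (mapFormula x.swap).swap := rfl

theorem swap_mem {x : ℝ × ℝ} (hx : x ∈ triangle) : x.swap ∈ triangle := by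
  obtain ⟨h1, h2, h3, h4, h5⟩ := hx
  exact ⟨h3, h4, h1, h2, by simpa [add_comm] using h5⟩

theorem invFormula_mem {x : ℝ × ℝ} (hx : x ∈ triangle) : invFormula x ∈ triangle :=
  swap_mem (mapFormula_mem (swap_mem hx))

theorem invFormula_mapFormula {x : ℝ × ℝ} (hx : x ∈ triangle) :
    invFormula (mapFormula x) = x := by
  obtain ⟨h1, h2, h3, h4, h5⟩ := hx
  have hk : index (mapFormula x).swap = index x := by
    have h0 : ⌊(1 - x.1) / x.2⌋ = 0 := by
      rw [Int.floor_eq_zero_iff]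
      exact ⟨div_nonneg (by linarith) h3.le, (div_lt_one h3).2 (by linarith)⟩
    have h : (1 + (-x.1 + (index x : ℝ) * x.2)) / x.2 = (1 - x.1) / x.2 + (index x : ℝ) := by
      field_simp
      ring
    have h' : index (mapFormula x).swap = ⌊(1 + (-x.1 + (index x : ℝ) * x.2)) / x.2⌋ := rfl
    rw [h', h, Int.floor_add_intCast, h0, zero_add]
  refine Prod.ext ?_ rfl
  simp only [invFormula, hk]
  simp only [mapFormula]
  ring

theorem mapFormula_invFormula {x : ℝ × ℝ} (hx : x ∈ triangle) :
    mapFormula (invFormula x) = x := by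
  have h := invFormula_mapFormula (swap_mem hx)
  rw [invFormula_eq_swap] at h
  rw [invFormula_eq_swap]
  exact Prod.swap_injective h

/-- The BCZ map `T (a, b) = (b, -a + [(1 + a) / b] b)`, a bijection of the triangle. -/
def T : Equiv.Perm triangle where
  toFun x := ⟨mapFormula x, mapFormula_mem x.2⟩
  invFun x := ⟨invFormula x, invFormula_mem x.2⟩
  left_inv x := Subtype.ext (invFormula_mapFormula x.2)
  right_inv x := Subtype.ext (mapFormula_invFormula x.2)

/-- The itinerary sequence `k_n(a, b) = k(T^{n-1}(a, b))`, `n ∈ ℤ`. -/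
def itinerary (x : triangle) (n : ℤ) : ℤ := index ((T ^ (n - 1)) x : triangle)

/-- The forward partial sums `f_n = ∑_{i=1}^n (k_i - 3)`. -/
def forwardSum (x : triangle) (n : ℕ) : ℤ :=
  ∑ i ∈ Finset.Icc 1 n, (itinerary x (i : ℤ) - 3)

/-- The backward partial sums `f_{-n} = ∑_{i=0}^n (k_{-i} - 3)`. -/
def backwardSum (x : triangle) (n : ℕ) : ℤ :=
  ∑ i ∈ Finset.Icc 0 n, (itinerary x (-(i : ℤ)) - 3)

/-- The Diophantine exponent of `s`, as an extended real number (a rational number `r = p / q`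
is written in lowest terms with `q = r.den > 0`). -/
def exponent (s : ℝ) : EReal :=
  sSup ((fun v : ℝ => (v : EReal)) ''
    {v : ℝ | {r : ℚ | |s - (r : ℝ)| < 1 / (r.den : ℝ) ^ v}.Infinite})

/-- The even Diophantine exponent of `s` (approximation from above). -/
def evenExponent (s : ℝ) : EReal :=
  sSup ((fun v : ℝ => (v : EReal)) ''
    {v : ℝ | {r : ℚ | 0 < (r : ℝ) - s ∧ (r : ℝ) - s < 1 / (r.den : ℝ) ^ v}.Infinite})

/-- The odd Diophantine exponent of `s` (approximation from below). -/
def oddExponent (s : ℝ) : EReal :=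
  sSup ((fun v : ℝ => (v : EReal)) ''
    {v : ℝ | {r : ℚ | 0 < s - (r : ℝ) ∧ s - (r : ℝ) < 1 / (r.den : ℝ) ^ v}.Infinite})

/-- `limsup_{n → ∞} log |f n| / log n`, as an extended real number. (The indices with `f n = 0`
contribute `0` through `Real.log 0 = 0`, and not `-∞`; the others with `n ≥ 2` contribute
numbers `≥ 0`, so this is immaterial for the assertion that the value is a given positive
number.) -/
def logSpeed (f : ℕ → ℤ) : EReal :=
  limsup (fun n : ℕ => ((Real.log |(f n : ℝ)| / Real.log (n : ℝ) : ℝ) : EReal)) atTop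

end BCZ

end

/-! The orbit values x_j are the values of (p, q) ↦ pa + qb along integer vectors with consecutive
determinants 1, and the indices are (x_j + x_{j+2}) / x_{j+1}. Hence f_n is, up to end terms, the
weight of a unimodular path (`forwardSum_eq_weight`), and this weight is invariant under insertion
of mediants.

Upper bound: deleting mediants leaves a path with the same ends and weight along which the values
are convex, hence of bounded variation. If b/a is not approximable beyond exponent 2, the values on
a path of slopes at most L are at least 1/K, with K of order L^((1+ε)/2). The same Diophantine bound
for the difference vectors leaves only O(K) edges, so the weight is O(K) (`abs_weight_le`). Since
`slope_le_weight` then forces L = O(n), f_n = O(n^((1+ε)/2)).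

Lower bound: one-sided Dirichlet approximation gives vectors of value y < 1/q with q arbitrarily
large. The orbit meets each of their directions (`exists_orbit_le`), at a time j where the index is
at least 1/y ≥ √(aj). Such a jump makes f large just before or just after it (`forwardSum_lower`).

Swapping the coordinates reverses time, so f_{-n} is a forward sum for the ratio a/b. Almost every
ratio is irrational and not Liouville for any exponent above 2; with Dirichlet approximation on each
side this also gives the three exponents. -/

noncomputable section

namespace BCZ

/-! ### Unimodular paths and removal of mediants -/

/-- The linear form `(p, q) ↦ p a + q b` on integer vectors. -/
def form (a b : ℝ) (v : ℤ × ℤ) : ℝ := v.1 * a + v.2 * b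

/-- The determinant of two integer vectors. -/
def det (u v : ℤ × ℤ) : ℤ := u.1 * v.2 - u.2 * v.1

/-- The weight of an edge whose end points have the values `s` and `t`; the total weight of a
unimodular path does not change when a mediant is inserted. -/
def edge (s t : ℝ) : ℝ := s / t + t / s - 3

/-- The total weight of the first `N` edges of the path `w`. -/
def weight (a b : ℝ) (N : ℕ) (w : ℕ → ℤ × ℤ) : ℝ :=
  ∑ j ∈ Finset.range N, edge (form a b (w j)) (form a b (w (j + 1)))

/-- Paths with `N` edges and vertices in `S`, all of whose edges have determinant one. -/
structure UnimodularPath (S : Set (ℤ × ℤ)) (N : ℕ) (w : ℕ → ℤ × ℤ) : Prop where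
  mem : ∀ j ≤ N, w j ∈ S
  det_eq : ∀ j < N, det (w j) (w (j + 1)) = 1

theorem form_add (a b : ℝ) (u v : ℤ × ℤ) : form a b (u + v) = form a b u + form a b v := by
  simp only [form, Prod.fst_add, Prod.snd_add]
  push_cast
  ring

theorem form_sub (a b : ℝ) (u v : ℤ × ℤ) : form a b (u - v) = form a b u - form a b v := by
  simp only [form, Prod.fst_sub, Prod.snd_sub]
  push_cast
  ring

theorem form_smul (a b : ℝ) (k : ℤ) (v : ℤ × ℤ) : form a b (k • v) = k * form a b v := by
  simp only [form, Prod.smul_fst, Prod.smul_snd, smul_eq_mul]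
  push_cast
  ring

/-- This is the linear relation between three plane vectors, with their pairwise determinants as
coefficients. -/
theorem add_eq_det_smul {u v w : ℤ × ℤ} (h₁ : det u v = 1) (h₂ : det v w = 1) :
    u + w = det u w • v := by
  simp only [det] at *
  ext
  · simp only [Prod.fst_add, Prod.smul_fst, smul_eq_mul]
    linear_combination (-u.1) * h₂ - w.1 * h₁
  · simp only [Prod.snd_add, Prod.smul_snd, smul_eq_mul]
    linear_combination (-u.2) * h₂ - w.2 * h₁

/-- The constant 3 in `edge` is forced here: the four ratios on the left sum to s/t + t/s + 3, and
one more edge is counted. -/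
theorem edge_add_edge_mediant {s t : ℝ} (hs : 0 < s) (ht : 0 < t) :
    edge s (s + t) + edge (s + t) t = edge s t := by
  have : s + t ≠ 0 := by positivity
  unfold edge
  field_simp
  ring

/-- The index map that skips the value `j + 1`. -/
def skip (j i : ℕ) : ℕ := if i ≤ j then i else i + 1

theorem sum_skip (e : ℕ → ℕ → ℝ) (j r : ℕ) (h : e j (j + 1) + e (j + 1) (j + 2) = e j (j + 2)) :
    ∑ i ∈ Finset.range (j + 1 + r), e (skip j i) (skip j (i + 1)) =
      ∑ i ∈ Finset.range (j + 1 + r + 1), e i (i + 1) := by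
  induction r with
  | zero =>
    rw [add_zero, Finset.sum_range_succ, Finset.sum_range_succ, Finset.sum_range_succ, add_assoc, h]
    congr 1
    · refine Finset.sum_congr rfl fun i hi => ?_
      have := Finset.mem_range.1 hi
      simp [skip, this.le, Nat.succ_le_of_lt this]
    · simp [skip]
  | succ r ih =>
    rw [← add_assoc, Finset.sum_range_succ, ih, Finset.sum_range_succ _ (j + 1 + r + 1)]
    congr 2 <;> simp only [skip] <;> split_ifs <;> omega

/-- Removing the mediants, one obtains a path with the same ends and the same weight in which
consecutive vertices satisfy `u + w = k v` with `k ≥ 2`. -/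
theorem UnimodularPath.exists_reduced {a b : ℝ} {S : Set (ℤ × ℤ)}
    (hS : ∀ v ∈ S, 0 < form a b v) (N : ℕ) {w : ℕ → ℤ × ℤ} (hN : 1 ≤ N)
    (hw : UnimodularPath S N w) :
    ∃ (M : ℕ) (z : ℕ → ℤ × ℤ), 1 ≤ M ∧ UnimodularPath S M z ∧ z 0 = w 0 ∧ z M = w N ∧
      weight a b M z = weight a b N w ∧
      ∀ j, j + 1 < M → ∃ k : ℤ, 2 ≤ k ∧ z j + z (j + 2) = k • z (j + 1) := by
  induction N using Nat.strong_induction_on generalizing w with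
  | _ N ih =>
  by_cases hred : ∀ j, j + 1 < N → ∃ k : ℤ, 2 ≤ k ∧ w j + w (j + 2) = k • w (j + 1)
  · exact ⟨N, w, hN, hw, rfl, rfl, rfl, hred⟩
  push Not at hred
  obtain ⟨j, hj, hk⟩ := hred
  have heq := add_eq_det_smul (hw.det_eq j (by omega)) (hw.det_eq (j + 1) hj)
  have hlt : det (w j) (w (j + 2)) < 2 := by
    by_contra! h
    exact hk _ h heq
  have p0 := hS _ (hw.mem j (by omega))
  have p1 := hS _ (hw.mem (j + 1) (by omega))
  have p2 := hS _ (hw.mem (j + 2) (by omega))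
  have hf := congrArg (form a b) heq
  rw [form_add, form_smul] at hf
  -- Positivity of the forms makes the multiplier k in u + w = k v positive; being less than 2, it
  -- is 1, so the middle vertex is a mediant.
  have hpos : 0 < det (w j) (w (j + 2)) := by
    have : (0 : ℝ) < det (w j) (w (j + 2)) := pos_of_mul_pos_left (by rw [← hf]; positivity) p1.le
    exact_mod_cast this
  have hone : det (w j) (w (j + 2)) = 1 := by omega
  rw [hone, Int.cast_one, one_mul] at hf
  obtain ⟨r, rfl⟩ : ∃ r, N = j + 1 + r + 1 := ⟨N - j - 2, by omega⟩
  have hpath : UnimodularPath S (j + 1 + r) (fun i => w (skip j i)) := by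
    refine ⟨fun i hi => hw.mem _ ?_, fun i hi => ?_⟩
    · simp only [skip]; split_ifs <;> omega
    · rcases lt_trichotomy i j with h | h | h
      · simpa [skip, h.le, Nat.succ_le_of_lt h] using hw.det_eq i (by omega)
      · subst h; simpa [skip] using hone
      · have h1 : ¬ i ≤ j := by omega
        have h2 : ¬ i + 1 ≤ j := by omega
        simpa [skip, h1, h2] using hw.det_eq (i + 1) (by omega)
  obtain ⟨M, z, hM, hz, hz0, hzM, hzw, hzk⟩ := ih _ (by omega) (by omega) hpath
  refine ⟨M, z, hM, hz, by simpa [skip] using hz0, ?_, ?_, hzk⟩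
  · have h1 : ¬ j + 1 + r ≤ j := by omega
    simpa [skip, h1] using hzM
  · rw [hzw]
    refine sum_skip (fun i l => edge (form a b (w i)) (form a b (w l))) j r ?_
    rw [← hf]
    exact edge_add_edge_mediant p0 p2

/-! ### Convexity and the bound for the weight -/

/-- The total variation of a convex sequence with nonnegative terms is at most the sum of its
end values. -/
theorem sum_abs_sub_le_of_convex (x : ℕ → ℝ) (M : ℕ) (h0 : ∀ j ≤ M, 0 ≤ x j)
    (hc : ∀ j, j + 1 < M → x (j + 1) - x j ≤ x (j + 2) - x (j + 1)) :
    ∑ j ∈ Finset.range M, |x (j + 1) - x j| ≤ x 0 + x M := by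
  -- The first clause records that, by convexity, a last step that does not increase means that no
  -- earlier step did, so the sum telescopes.
  suffices H : ∀ m ≤ M,
      (∀ l, m = l + 1 → x (l + 1) ≤ x l →
        ∑ j ∈ Finset.range m, |x (j + 1) - x j| = x 0 - x m) ∧
      ∑ j ∈ Finset.range m, |x (j + 1) - x j| ≤ x 0 + x m from (H M le_rfl).2
  intro m
  induction m with
  | zero =>
    intro _
    refine ⟨fun l hl => by omega, ?_⟩
    simpa using h0 0 (by omega)
  | succ m ih =>
    intro hm
    obtain ⟨ih1, ih2⟩ := ih (by omega)
    have key : x (m + 1) ≤ x m →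
        ∑ j ∈ Finset.range (m + 1), |x (j + 1) - x j| = x 0 - x (m + 1) := by
      intro h
      rw [Finset.sum_range_succ, abs_of_nonpos (by linarith)]
      rcases m with _ | l
      · simp
      · rw [ih1 l rfl (by linarith [hc l (by omega)])]
        ring
    refine ⟨fun l hl h => ?_, ?_⟩
    · obtain rfl : m = l := by omega
      exact key h
    · rcases le_total (x (m + 1)) (x m) with h | h
      · rw [key h]
        linarith [h0 (m + 1) hm]
      · rw [Finset.sum_range_succ, abs_of_nonneg (by linarith)]
        linarith

/-- The edge weight is (t - s)² / (st) - 1, and |t - s| ≤ max s t ≤ K s t because min s t ≥ 1/K. -/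
theorem abs_edge_le {s t K : ℝ} (hs : 0 < s) (ht : 0 < t) (hKs : 1 ≤ K * s) (hKt : 1 ≤ K * t) :
    |edge s t| ≤ K * |t - s| + 1 := by
  have h : edge s t = (t - s) ^ 2 / (s * t) - 1 := by
    unfold edge
    field_simp
    ring
  have h1 : (t - s) ^ 2 / (s * t) ≤ K * |t - s| := by
    rw [div_le_iff₀ (by positivity), ← sq_abs]
    have h2 : |t - s| ≤ K * (s * t) := by
      rw [abs_le]
      constructor <;> nlinarith
    nlinarith [abs_nonneg (t - s)]
  have h2 : 0 ≤ (t - s) ^ 2 / (s * t) := by positivity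
  rw [h, abs_le]
  constructor <;> linarith

/-- The integer vectors `v` in the strip `0 < form a b v ≤ 1` under a line of slope `L`. -/
def strip (a b L : ℝ) : Set (ℤ × ℤ) :=
  {v | 0 < form a b v ∧ form a b v ≤ 1 ∧ 0 ≤ v.2 ∧ (v.2 : ℝ) ≤ L * form a b v}

/-- In the strip q is at most L times the form, so the Diophantine bound `hD` on form times q
becomes a bound on the square of the form. -/
theorem one_le_mul_form {a b L K : ℝ} (hL : 0 < L)
    (hD : ∀ p q : ℤ, 1 ≤ q → (q : ℝ) ≤ L → L ≤ K ^ 2 * (|p * a + q * b| * q))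
    (hK : 0 < K) {v : ℤ × ℤ} (hv : v ∈ strip a b L) (hq : 1 ≤ v.2) : 1 ≤ K * form a b v := by
  obtain ⟨h1, h2, -, h4⟩ := hv
  have h := hD v.1 v.2 hq (by nlinarith)
  change L ≤ K ^ 2 * (|form a b v| * v.2) at h
  rw [abs_of_pos h1] at h
  have h5 : L ≤ L * (K * form a b v) ^ 2 :=
    calc L ≤ K ^ 2 * (form a b v * v.2) := h
      _ ≤ K ^ 2 * (form a b v * (L * form a b v)) := by gcongr
      _ = L * (K * form a b v) ^ 2 := by ring
  have h6 : 1 ≤ (K * form a b v) ^ 2 := by nlinarith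
  nlinarith [mul_pos hK h1]

/-- On the reduced path bounded variation controls the sum of K|Δx|, and the number of edges is
itself O(K); together these bound the sum of the edge weights. -/
theorem abs_weight_le {a b L K : ℝ} (hL : 0 < L) (hK : 0 < K) (haK : 1 ≤ K * a)
    (hD : ∀ p q : ℤ, 1 ≤ q → (q : ℝ) ≤ L → L ≤ K ^ 2 * (|p * a + q * b| * q))
    {N : ℕ} (hN : 1 ≤ N) {w : ℕ → ℤ × ℤ} (hw : UnimodularPath (strip a b L) N w)
    (hw0 : w 0 = (1, 0)) : |weight a b N w| ≤ 4 * K := by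
  obtain ⟨M, z, hM, hz, hz0, -, hzw, hzk⟩ :=
    UnimodularPath.exists_reduced (a := a) (b := b) (fun v hv => hv.1) N hN hw
  rw [hw0] at hz0
  rw [← hzw]
  set x : ℕ → ℝ := fun j => form a b (z j) with hx
  have hxpos : ∀ j ≤ M, 0 < x j := fun j hj => (hz.mem j hj).1
  have hx1 : ∀ j ≤ M, x j ≤ 1 := fun j hj => (hz.mem j hj).2.1
  have hq0 : ∀ j ≤ M, 0 ≤ (z j).2 := fun j hj => (hz.mem j hj).2.2.1
  have hqL : ∀ j ≤ M, ((z j).2 : ℝ) ≤ L := fun j hj => by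
    have := (hz.mem j hj).2.2.2
    nlinarith [hx1 j hj]
  -- The first increment of q is 1 since the path starts at (1, 0); reducedness (k ≥ 2) makes the
  -- increments nondecreasing.
  have hdq : ∀ j < M, 1 ≤ (z (j + 1)).2 - (z j).2 := by
    intro j
    induction j with
    | zero =>
      intro hj
      have := hz.det_eq 0 hj
      simp only [det, hz0] at this
      simp only [hz0]
      omega
    | succ j ih =>
      intro hj
      obtain ⟨k, hk, hzk⟩ := hzk j hj
      have h := congrArg Prod.snd hzk
      simp only [Prod.snd_add, Prod.smul_snd, smul_eq_mul] at h
      have h1 := ih (by omega)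
      have h2 := hq0 (j + 1) (by omega)
      change 1 ≤ (z (j + 2)).2 - (z (j + 1)).2
      nlinarith
  have hconv : ∀ j, j + 1 < M → x (j + 1) - x j ≤ x (j + 2) - x (j + 1) := by
    intro j hj
    obtain ⟨k, hk, hzk⟩ := hzk j hj
    have h := congrArg (form a b) hzk
    rw [form_add, form_smul] at h
    have h1 := hxpos (j + 1) (by omega)
    have h2 : (2 : ℝ) ≤ k := by exact_mod_cast hk
    simp only [hx] at *
    nlinarith
  have hKx : ∀ j ≤ M, 1 ≤ K * x j := by
    intro j hj
    rcases j with _ | j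
    · simpa [hx, hz0, form] using haK
    · refine one_le_mul_form hL hD hK (hz.mem _ hj) ?_
      linarith [hdq j (by omega), hq0 j (by omega)]
  have htv : ∑ j ∈ Finset.range M, |x (j + 1) - x j| ≤ 2 := by
    have := sum_abs_sub_le_of_convex x M (fun j hj => (hxpos j hj).le) hconv
    linarith [hx1 0 (by omega), hx1 M le_rfl]
  -- `hD` for the difference vector says that the two summands have product at least 1; AM–GM then
  -- gives sum at least 2.
  have hedge : ∀ j < M, 2 ≤ K * |x (j + 1) - x j| + K / L * ((z (j + 1)).2 - (z j).2) := by
    intro j hj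
    have h1 := hdq j hj
    have h2 : (((z (j + 1)).2 - (z j).2 : ℤ) : ℝ) ≤ L := by
      push_cast
      have : (0 : ℝ) ≤ (z j).2 := by exact_mod_cast hq0 j hj.le
      linarith [hqL (j + 1) hj]
    have h3 := hD ((z (j + 1)).1 - (z j).1) _ h1 h2
    have h4 : (((z (j + 1)).1 - (z j).1 : ℤ) : ℝ) * a + (((z (j + 1)).2 - (z j).2 : ℤ) : ℝ) * b =
        x (j + 1) - x j := (form_sub a b (z (j + 1)) (z j))
    rw [h4] at h3
    push_cast at h3
    have h5 : 1 ≤ (K * |x (j + 1) - x j|) * (K / L * ((z (j + 1)).2 - (z j).2)) := by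
      have : (K * |x (j + 1) - x j|) * (K / L * ((z (j + 1)).2 - (z j).2)) =
        (K ^ 2 * (|x (j + 1) - x j| * ((z (j + 1)).2 - (z j).2))) / L := by
        field_simp
      rw [this, one_le_div hL]
      exact h3
    have h6 : (1 : ℝ) ≤ (z (j + 1)).2 - (z j).2 := by exact_mod_cast h1
    have h7 : 0 ≤ K * |x (j + 1) - x j| := by positivity
    have h8 : 0 ≤ K / L * ((z (j + 1)).2 - (z j).2 : ℝ) := by
      have : (0 : ℝ) ≤ (z (j + 1)).2 - (z j).2 := by linarith
      positivity
    nlinarith [sq_nonneg (K * |x (j + 1) - x j| - K / L * ((z (j + 1)).2 - (z j).2))]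
  -- Summed over the edges, the variation contributes at most 2K and the telescoping q-increments at
  -- most K.
  have hMK : (M : ℝ) * 2 ≤ 3 * K := by
    have h1 := Finset.sum_le_sum fun j hj => hedge j (Finset.mem_range.1 hj)
    rw [Finset.sum_const, Finset.card_range, nsmul_eq_mul, Finset.sum_add_distrib,
      ← Finset.mul_sum, ← Finset.mul_sum,
      Finset.sum_range_sub (fun j => ((z j).2 : ℝ)), hz0] at h1
    have h2 : K / L * ((z M).2 - ((1, 0) : ℤ × ℤ).2 : ℝ) ≤ K := by
      rw [div_mul_eq_mul_div, div_le_iff₀ hL]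
      push_cast
      nlinarith [hqL M le_rfl]
    nlinarith
  calc |weight a b M z| ≤ ∑ j ∈ Finset.range M, |edge (x j) (x (j + 1))| :=
        Finset.abs_sum_le_sum_abs _ _
    _ ≤ ∑ j ∈ Finset.range M, (K * |x (j + 1) - x j| + 1) := by
        refine Finset.sum_le_sum fun j hj => ?_
        have hj := Finset.mem_range.1 hj
        exact abs_edge_le (hxpos j hj.le) (hxpos (j + 1) hj) (hKx j hj.le) (hKx (j + 1) hj)
    _ ≤ 4 * K := by
        rw [Finset.sum_add_distrib, ← Finset.mul_sum, Finset.sum_const, Finset.card_range,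
          nsmul_eq_mul, mul_one]
        nlinarith

/-! ### Orbits and time reversal -/

/-- The first coordinates of the forward orbit. -/
def orbit (x : triangle) (j : ℕ) : ℝ := ((T ^ j) x : ℝ × ℝ).1

/-- The indices along the forward orbit. -/
def orbitIndex (x : triangle) (j : ℕ) : ℤ := index ((T ^ j) x : ℝ × ℝ)

theorem coe_T (x : triangle) : (T x : ℝ × ℝ) = mapFormula x := rfl

theorem coe_T_pow_succ (x : triangle) (j : ℕ) :
    ((T ^ (j + 1)) x : ℝ × ℝ) = mapFormula ((T ^ j) x : ℝ × ℝ) := by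
  rw [pow_succ', Equiv.Perm.mul_apply, coe_T]

theorem orbit_succ (x : triangle) (j : ℕ) : orbit x (j + 1) = ((T ^ j) x : ℝ × ℝ).2 := by
  rw [orbit, coe_T_pow_succ]; rfl

theorem orbit_add_two (x : triangle) (j : ℕ) :
    orbit x (j + 2) = orbitIndex x j * orbit x (j + 1) - orbit x j := by
  rw [orbit_succ x (j + 1), coe_T_pow_succ, orbit_succ]
  simp only [mapFormula, orbit, orbitIndex]
  ring

theorem orbit_pos (x : triangle) (j : ℕ) : 0 < orbit x j := ((T ^ j) x).2.1

theorem orbit_le_one (x : triangle) (j : ℕ) : orbit x j ≤ 1 := ((T ^ j) x).2.2.1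

theorem one_lt_orbit_add (x : triangle) (j : ℕ) : 1 < orbit x j + orbit x (j + 1) := by
  rw [orbit_succ]
  exact ((T ^ j) x).2.2.2.2.2

theorem itinerary_succ (x : triangle) (n : ℕ) : itinerary x ((n : ℤ) + 1) = orbitIndex x n := by
  rw [itinerary, add_sub_cancel_right, zpow_natCast, orbitIndex]

theorem forwardSum_succ (x : triangle) (n : ℕ) :
    forwardSum x (n + 1) = forwardSum x n + (orbitIndex x n - 3) := by
  rw [forwardSum, forwardSum, Finset.sum_Icc_succ_top (by omega), Nat.cast_succ, itinerary_succ]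

theorem forwardSum_eq (x : triangle) (n : ℕ) :
    forwardSum x n = ∑ j ∈ Finset.range n, (orbitIndex x j - 3) := by
  induction n with
  | zero => simp [forwardSum]
  | succ n ih => rw [forwardSum_succ, ih, Finset.sum_range_succ]

/-- The involution `(a, b) ↦ (b, a)` of the triangle. -/
def flip (x : triangle) : triangle := ⟨x.1.swap, swap_mem x.2⟩

theorem flip_flip (x : triangle) : flip (flip x) = x := rfl

theorem T_symm_eq (x : triangle) : T.symm x = flip (T (flip x)) := rfl

theorem T_inv_pow_eq (x : triangle) (n : ℕ) : (T⁻¹ ^ n) x = flip ((T ^ n) (flip x)) := by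
  induction n with
  | zero => rfl
  | succ n ih =>
    rw [pow_succ', pow_succ', Equiv.Perm.mul_apply, Equiv.Perm.mul_apply, ih]
    change T.symm _ = _
    rw [T_symm_eq, flip_flip]

/-- The index is the multiplier in x_{j-1} + x_{j+1} = k x_j, a relation symmetric under time
reversal. -/
theorem index_T_symm (x : triangle) : index (T.symm x : ℝ × ℝ) = index (flip x : ℝ × ℝ) := by
  have hb : 0 < (T.symm x : ℝ × ℝ).2 := (T.symm x).2.2.2.1
  have h : mapFormula (T.symm x : ℝ × ℝ) = x := congrArg Subtype.val (T.apply_symm_apply x)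
  have h' : invFormula (x : ℝ × ℝ) = (T.symm x : ℝ × ℝ) := rfl
  have h1 := congrArg Prod.snd h
  have h2 := congrArg Prod.fst h'
  have h3 := congrArg Prod.fst h
  simp only [mapFormula, invFormula] at h1 h2 h3
  rw [← h3] at h2
  have h4 : ((index (T.symm x : ℝ × ℝ) : ℝ) - index ((x : ℝ × ℝ).swap)) *
      (T.symm x : ℝ × ℝ).2 = 0 := by linarith
  rcases mul_eq_zero.1 h4 with h5 | h5
  · exact_mod_cast sub_eq_zero.1 h5
  · exact absurd h5 hb.ne'

/-- The shift n - 1 in `itinerary` leaves one extra inverse step, which `index_T_symm` absorbs. -/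
theorem itinerary_neg (x : triangle) (n : ℕ) : itinerary x (-(n : ℤ)) = orbitIndex (flip x) n := by
  have h : (T ^ (-(n : ℤ) - 1)) x = T.symm ((T⁻¹ ^ n) x) := by
    have : T ^ (-(n : ℤ) - 1) = T⁻¹ * T⁻¹ ^ n := by
      rw [← pow_succ', ← zpow_natCast, inv_zpow, ← zpow_neg]
      congr 1
      push_cast
      ring
    rw [this]; rfl
  rw [itinerary, h, index_T_symm, T_inv_pow_eq, flip_flip, orbitIndex]

theorem backwardSum_eq (x : triangle) (n : ℕ) :
    backwardSum x n = forwardSum (flip x) (n + 1) := by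
  rw [forwardSum_eq, backwardSum, ← Nat.range_succ_eq_Icc_zero]
  exact Finset.sum_congr rfl fun i _ => by rw [itinerary_neg]

/-! ### Orbit vectors, slopes and the weight formula -/

/-- The integer vectors whose forms are the orbit values. -/
def vec (x : triangle) : ℕ → ℤ × ℤ
  | 0 => (1, 0)
  | 1 => (0, 1)
  | j + 2 => orbitIndex x j • vec x (j + 1) - vec x j

theorem form_vec (x : triangle) (j : ℕ) : form x.1.1 x.1.2 (vec x j) = orbit x j := by
  induction j using Nat.twoStepInduction with
  | zero => simp [vec, form, orbit]
  | one => simp [vec, form, orbit_succ]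
  | more j h1 h2 => rw [vec, form_sub, form_smul, h1, h2, orbit_add_two]

theorem det_vec (x : triangle) (j : ℕ) : det (vec x j) (vec x (j + 1)) = 1 := by
  induction j with
  | zero => simp [vec, det]
  | succ j ih =>
    rw [← ih]
    simp only [vec, det, Prod.fst_sub, Prod.snd_sub, Prod.smul_fst, Prod.smul_snd, smul_eq_mul]
    ring

/-- For positive forms this compares slopes by the sign of a determinant. -/
theorem form_mul_snd_sub (a b : ℝ) (u v : ℤ × ℤ) :
    form a b u * v.2 - form a b v * u.2 = a * det u v := by
  simp only [form, det]
  push_cast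
  ring

/-- The slopes of the vectors of the orbit. -/
def slope (x : triangle) (j : ℕ) : ℝ := (vec x j).2 / orbit x j

theorem slope_zero (x : triangle) : slope x 0 = 0 := by simp [slope, vec]

theorem slope_succ (x : triangle) (j : ℕ) :
    slope x (j + 1) = slope x j + x.1.1 / (orbit x j * orbit x (j + 1)) := by
  have h := form_mul_snd_sub x.1.1 x.1.2 (vec x j) (vec x (j + 1))
  rw [det_vec, form_vec, form_vec, Int.cast_one, mul_one] at h
  have h1 := (orbit_pos x j).ne'
  have h2 := (orbit_pos x (j + 1)).ne'
  rw [slope, slope]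
  field_simp
  linarith

theorem slope_add_le (x : triangle) (j : ℕ) : slope x j + x.1.1 ≤ slope x (j + 1) := by
  rw [slope_succ]
  have h1 := orbit_pos x j
  have h2 := orbit_pos x (j + 1)
  have ha : 0 < x.1.1 := x.2.1
  gcongr
  rw [le_div_iff₀ (by positivity)]
  have : orbit x j * orbit x (j + 1) ≤ 1 := by
    nlinarith [orbit_le_one x j, orbit_le_one x (j + 1)]
  nlinarith

theorem strictMono_slope (x : triangle) : StrictMono (slope x) :=
  strictMono_nat_of_lt_succ fun j => by
    have ha : 0 < x.1.1 := x.2.1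
    linarith [slope_add_le x j]

theorem mul_le_slope (x : triangle) (j : ℕ) : x.1.1 * j ≤ slope x j := by
  induction j with
  | zero => simp [slope_zero]
  | succ j ih =>
    push_cast
    linarith [slope_add_le x j]

theorem vec_snd_eq (x : triangle) (j : ℕ) : ((vec x j).2 : ℝ) = slope x j * orbit x j := by
  rw [slope, div_mul_cancel₀ _ (orbit_pos x j).ne']

theorem vec_snd_nonneg (x : triangle) (j : ℕ) : 0 ≤ (vec x j).2 := by
  have ha : 0 < x.1.1 := x.2.1
  have h1 : (0 : ℝ) ≤ slope x j := le_trans (by positivity) (mul_le_slope x j)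
  have : (0 : ℝ) ≤ (vec x j).2 := by
    rw [vec_snd_eq]
    exact mul_nonneg h1 (orbit_pos x j).le
  exact_mod_cast this

theorem unimodularPath_vec (x : triangle) (N : ℕ) :
    UnimodularPath (strip x.1.1 x.1.2 (slope x N)) N (vec x) := by
  refine ⟨fun j hj => ?_, fun j _ => det_vec x j⟩
  refine ⟨?_, ?_, vec_snd_nonneg x j, ?_⟩
  · rw [form_vec]; exact orbit_pos x j
  · rw [form_vec]; exact orbit_le_one x j
  · rw [form_vec, vec_snd_eq]
    exact mul_le_mul_of_nonneg_right ((strictMono_slope x).monotone hj) (orbit_pos x j).le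

/-- Each index is a sum of two ratios of neighbouring values. Regrouped by edges, n indices fill n +
1 edges except for the two outermost ratios. -/
theorem forwardSum_eq_weight (x : triangle) (n : ℕ) :
    (forwardSum x n : ℝ) = weight x.1.1 x.1.2 (n + 1) (vec x) + 3
      - orbit x 1 / orbit x 0 - orbit x n / orbit x (n + 1) := by
  induction n with
  | zero =>
    simp [forwardSum_eq, weight, form_vec, edge]
  | succ n ih =>
    have h := orbit_add_two x n
    have h1 := (orbit_pos x (n + 1)).ne'
    have hk : (orbitIndex x n : ℝ) = (orbit x (n + 2) + orbit x n) / orbit x (n + 1) := by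
      rw [eq_div_iff h1]; linarith
    rw [forwardSum_succ, weight, Finset.sum_range_succ, ← weight]
    push_cast
    rw [ih, form_vec, form_vec, edge, hk]
    ring

/-- The edge weight plus 5 is (s + t)² / (st), which exceeds 1 / (st) as s + t > 1; and a / (st) is
the slope increment. -/
theorem slope_le_weight (x : triangle) (N : ℕ) :
    slope x N ≤ x.1.1 * (weight x.1.1 x.1.2 N (vec x) + 5 * N) := by
  have ha : 0 < x.1.1 := x.2.1
  induction N with
  | zero => simp [slope_zero, weight]
  | succ N ih =>
    have h1 := orbit_pos x N
    have h2 := orbit_pos x (N + 1)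
    have h3 : 1 / (orbit x N * orbit x (N + 1)) ≤ edge (orbit x N) (orbit x (N + 1)) + 5 := by
      have : edge (orbit x N) (orbit x (N + 1)) + 5 =
          (orbit x N + orbit x (N + 1)) ^ 2 / (orbit x N * orbit x (N + 1)) := by
        unfold edge
        field_simp
        ring
      rw [this]
      gcongr
      nlinarith [one_lt_orbit_add x N]
    rw [slope_succ, weight, Finset.sum_range_succ, ← weight, form_vec, form_vec]
    push_cast
    have h4 : x.1.1 / (orbit x N * orbit x (N + 1)) =
      x.1.1 * (1 / (orbit x N * orbit x (N + 1))) := by ring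
    rw [h4]
    nlinarith

/-- Every integer vector in the strip is dominated by a vector of the orbit of the same slope. -/
theorem exists_orbit_le (x : triangle) {v : ℤ × ℤ} (h0 : 0 < form x.1.1 x.1.2 v)
    (h1 : form x.1.1 x.1.2 v ≤ 1) (hq : 0 < v.2) :
    ∃ j, orbit x j ≤ form x.1.1 x.1.2 v ∧ slope x j = v.2 / form x.1.1 x.1.2 v := by
  set a := x.1.1
  set b := x.1.2
  have ha : 0 < a := x.2.1
  have hex : ∃ j, (v.2 : ℝ) / form a b v < slope x j := by
    obtain ⟨j, hj⟩ := exists_nat_gt ((v.2 : ℝ) / form a b v / a)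
    rw [div_lt_iff₀ ha] at hj
    exact ⟨j, by linarith [mul_le_slope x j]⟩
  -- The least J whose slope exceeds that of v puts v in the cone of the consecutive vectors J - 1
  -- and J, a basis of the lattice.
  classical
  have hspec := Nat.find_spec hex
  have hmin := fun m => Nat.find_min (m := m) hex
  generalize Nat.find hex = J at *
  rcases J with _ | j
  · rw [slope_zero] at hspec
    have : (0 : ℝ) < v.2 := by exact_mod_cast hq
    have : 0 < (v.2 : ℝ) / form a b v := by positivity
    linarith
  have hle := not_lt.1 (hmin j (by omega))
  have x0 := orbit_pos x j
  have x1 := orbit_pos x (j + 1)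
  have hα : 0 < det v (vec x (j + 1)) := by
    have h := form_mul_snd_sub a b v (vec x (j + 1))
    rw [form_vec] at h
    rw [slope, div_lt_div_iff₀ h0 x1] at hspec
    have : 0 < a * (det v (vec x (j + 1)) : ℝ) := by linarith
    exact_mod_cast pos_of_mul_pos_right this ha.le
  have hβ : 0 ≤ det (vec x j) v := by
    have h := form_mul_snd_sub a b (vec x j) v
    rw [form_vec] at h
    rw [slope, div_le_div_iff₀ x0 h0] at hle
    have : 0 ≤ a * (det (vec x j) v : ℝ) := by linarith
    exact_mod_cast nonneg_of_mul_nonneg_right this ha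
  have hdec : v = det v (vec x (j + 1)) • vec x j + det (vec x j) v • vec x (j + 1) := by
    have h := det_vec x j
    simp only [det] at h ⊢
    ext
    · simp only [Prod.fst_add, Prod.smul_fst, smul_eq_mul]
      linear_combination (-v.1) * h
    · simp only [Prod.snd_add, Prod.smul_snd, smul_eq_mul]
      linear_combination (-v.2) * h
  have hform := congrArg (form a b) hdec
  rw [form_add, form_smul, form_smul, form_vec, form_vec] at hform
  have hα1 : (1 : ℝ) ≤ det v (vec x (j + 1)) := by exact_mod_cast hα
  -- Two positive integer coefficients would give v a form of at least x_j + x_{j+1} > 1.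
  have hβ0 : det (vec x j) v = 0 := by
    by_contra hne
    have : (1 : ℝ) ≤ det (vec x j) v := by
      have : 1 ≤ det (vec x j) v := by omega
      exact_mod_cast this
    nlinarith [one_lt_orbit_add x j]
  refine ⟨j, ?_, ?_⟩
  · rw [hform, hβ0]
    push_cast
    nlinarith
  · have h := form_mul_snd_sub a b (vec x j) v
    rw [form_vec, hβ0] at h
    rw [slope, div_eq_div_iff x0.ne' h0.ne']
    push_cast at h
    linarith

/-! ### The Diophantine condition and the upper bound -/

theorem eventually_le_abs_sub_div {s v : ℝ} (hs : Irrational s) (hL : ¬ LiouvilleWith v s) :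
    ∀ᶠ n : ℕ in atTop, ∀ m : ℤ, 1 / (n : ℝ) ^ v ≤ |s - m / n| := by
  simp only [LiouvilleWith, not_exists, not_frequently] at hL
  filter_upwards [hL 1] with n hn m
  by_contra! h
  refine hn m ⟨fun he => hs ⟨m / n, ?_⟩, h⟩
  rw [he]
  push_cast
  rfl

/-- Large denominators are covered by the failure of the Liouville condition; the finitely many
others stay at a positive distance δ from the irrational s. -/
theorem exists_pos_le_abs_sub_mul_rpow {s ε : ℝ} (hs : Irrational s) (hε : 0 < ε)
    (hL : ¬ LiouvilleWith (2 + ε) s) :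
    ∃ c : ℝ, 0 < c ∧ ∀ p q : ℤ, 1 ≤ q → c ≤ |q * s - p| * (q : ℝ) ^ (1 + ε) := by
  obtain ⟨N, hN⟩ := eventually_atTop.1 (eventually_le_abs_sub_div hs hL)
  obtain ⟨δ, hδ, hδ0⟩ := (((hs.eventually_forall_le_dist_cast_div_of_denom_le N).filter_mono
    nhdsWithin_le_nhds).and (self_mem_nhdsWithin (s := Set.Ioi (0 : ℝ)))).exists
  refine ⟨min δ 1, lt_min hδ0 one_pos, fun p q hq => ?_⟩
  lift q to ℕ using by omega
  have hq1 : (1 : ℝ) ≤ q := by exact_mod_cast hq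
  have hq0 : (0 : ℝ) < q := by linarith
  have heq : |((q : ℤ) : ℝ) * s - p| * (((q : ℤ) : ℝ)) ^ (1 + ε) =
      |s - p / q| * (q : ℝ) ^ (2 + ε) := by
    have h2 : (q : ℝ) * s - p = q * (s - p / q) := by field_simp
    have h3 : (q : ℝ) ^ (2 + ε) = q * (q : ℝ) ^ (1 + ε) := by
      rw [show 2 + ε = 1 + (1 + ε) by ring, Real.rpow_add hq0 1, Real.rpow_one]
    rw [Int.cast_natCast, h2, abs_mul, abs_of_pos hq0, h3]
    ring
  rw [heq]
  rcases le_total q N with h | h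
  · have h2 := hδ q h p
    rw [Real.dist_eq] at h2
    have h3 : 1 ≤ (q : ℝ) ^ (2 + ε) := Real.one_le_rpow hq1 (by linarith)
    calc min δ 1 ≤ δ := min_le_left _ _
      _ ≤ |s - p / q| := h2
      _ ≤ _ := le_mul_of_one_le_right (abs_nonneg _) h3
  · have h2 := hN q h p
    rw [div_le_iff₀ (by positivity)] at h2
    exact (min_le_right _ _).trans h2

theorem forwardSum_le_of_slope (x : triangle) {K : ℝ} (n : ℕ) (hK : 0 < K) (haK : 1 ≤ K * x.1.1)
    (hD : ∀ p q : ℤ, 1 ≤ q → (q : ℝ) ≤ slope x (n + 1) →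
      slope x (n + 1) ≤ K ^ 2 * (|p * x.1.1 + q * x.1.2| * q)) :
    |(forwardSum x n : ℝ)| ≤ 7 * K + 3 ∧ slope x (n + 1) ≤ 4 * K + 5 * (n + 1) := by
  have ha : 0 < x.1.1 := x.2.1
  have ha1 : x.1.1 ≤ 1 := x.2.2.1
  have hL : 0 < slope x (n + 1) := by
    have := strictMono_slope x (Nat.succ_pos n)
    rwa [slope_zero] at this
  have hw := unimodularPath_vec x (n + 1)
  have hW := abs_weight_le hL hK haK hD (by omega) hw rfl
  have hbase : orbit x 1 / orbit x 0 ≤ K := by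
    rw [div_le_iff₀ (orbit_pos x 0)]
    exact (orbit_le_one x 1).trans haK
  have hend : orbit x n / orbit x (n + 1) ≤ K := by
    rw [div_le_iff₀ (orbit_pos x _)]
    refine (orbit_le_one x n).trans ?_
    rw [← form_vec]
    refine one_le_mul_form hL hD hK (hw.mem _ le_rfl) ?_
    have : (0 : ℝ) < (vec x (n + 1)).2 := by
      rw [vec_snd_eq]
      exact mul_pos hL (orbit_pos x _)
    exact_mod_cast this
  have h0 : 0 < orbit x 1 / orbit x 0 := div_pos (orbit_pos x _) (orbit_pos x _)
  have h1 : 0 < orbit x n / orbit x (n + 1) := div_pos (orbit_pos x _) (orbit_pos x _)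
  rw [abs_le] at hW
  constructor
  · rw [forwardSum_eq_weight, abs_le]
    constructor <;> linarith
  · have h2 := slope_le_weight x (n + 1)
    have h3 := hL.trans_le h2
    push_cast at h2 h3
    have h4 := pos_of_mul_pos_right h3 ha.le
    nlinarith

theorem eventually_mul_rpow_le (C : ℝ) {δ : ℝ} (hδ : δ < 1) :
    ∀ᶠ L : ℝ in atTop, C * L ^ δ ≤ L := by
  filter_upwards [(tendsto_rpow_atTop (sub_pos.2 hδ)).eventually_ge_atTop C,
    eventually_gt_atTop 0] with L hL h0
  calc C * L ^ δ ≤ L ^ (1 - δ) * L ^ δ := by gcongr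
    _ = L := by rw [← Real.rpow_add h0, sub_add_cancel, Real.rpow_one]

/-- The upper bound for the growth of the forward partial sums. -/
theorem forwardSum_upper (x : triangle) (hs : Irrational (x.1.2 / x.1.1))
    (hL : ∀ p > (2 : ℝ), ¬ LiouvilleWith p (x.1.2 / x.1.1)) {ε : ℝ} (hε : 0 < ε) (hε1 : ε < 1) :
    ∃ C : ℝ, ∀ᶠ n : ℕ in atTop, |(forwardSum x n : ℝ)| ≤ C * (n : ℝ) ^ ((1 + ε) / 2) := by
  have ha : 0 < x.1.1 := x.2.1
  obtain ⟨c, hc, hcD⟩ := exists_pos_le_abs_sub_mul_rpow hs hε (hL _ (by linarith))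
  set a := x.1.1
  set b := x.1.2
  -- Chosen so that A, A a and A (a c) are all at least 1; then K = A L^((1+ε)/2) meets every
  -- hypothesis of `forwardSum_le_of_slope`.
  set A : ℝ := 1 / a + 1 / (a * c) + 1 with hA
  have hA1 : 1 ≤ A := by
    have : 0 < 1 / a + 1 / (a * c) := by positivity
    linarith
  have hAa : 1 ≤ A * a := by
    have : A * a = 1 + 1 / c + a := by rw [hA]; field_simp
    have : 0 < 1 / c := by positivity
    linarith
  have hAc : 1 ≤ A * (a * c) := by
    have : A * (a * c) = 1 + (c + a * c) := by rw [hA]; field_simp; ring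
    have : 0 < c + a * c := by positivity
    linarith
  have hbound : ∀ n : ℕ, 1 ≤ slope x (n + 1) →
      |(forwardSum x n : ℝ)| ≤ 7 * (A * slope x (n + 1) ^ ((1 + ε) / 2)) + 3 ∧
      slope x (n + 1) ≤ 4 * (A * slope x (n + 1) ^ ((1 + ε) / 2)) + 5 * (n + 1) := by
    intro n hn
    set L := slope x (n + 1)
    have hL0 : 0 < L := by linarith
    have hp : 1 ≤ L ^ ((1 + ε) / 2) := Real.one_le_rpow hn (by linarith)
    refine forwardSum_le_of_slope x n (by positivity) ?_ ?_
    · calc (1 : ℝ) ≤ A * a := hAa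
        _ = A * 1 * a := by ring
        _ ≤ _ := by gcongr
    · intro p q hq hqL
      have hq0 : (0 : ℝ) < q := by exact_mod_cast hq
      have h1 := hcD (-p) q hq
      have h2 : |p * a + q * b| = a * |q * (b / a) - (-p : ℤ)| := by
        rw [← abs_of_pos ha, ← abs_mul, abs_of_pos ha]
        congr 1
        push_cast
        field_simp
        ring
      have h3 : (A * L ^ ((1 + ε) / 2)) ^ 2 = A ^ 2 * (L ^ ε * L) := by
        rw [mul_pow, ← Real.rpow_natCast (L ^ _), ← Real.rpow_mul hL0.le,
          ← Real.rpow_add_one hL0.ne']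
        congr 2
        push_cast
        ring
      rw [Real.rpow_add hq0, Real.rpow_one] at h1
      have h4 : (q : ℝ) ^ ε ≤ L ^ ε := Real.rpow_le_rpow hq0.le hqL hε.le
      have h5 : c ≤ |q * (b / a) - (-p : ℤ)| * (q * L ^ ε) := h1.trans (by gcongr)
      have h6 : 0 < a * c := by positivity
      rw [h2, h3]
      calc L ≤ (A * (A * (a * c))) * L :=
          le_mul_of_one_le_left hL0.le (one_le_mul_of_one_le_of_one_le hA1 hAc)
        _ = A ^ 2 * a * L * c := by ring
        _ ≤ A ^ 2 * a * L * (|q * (b / a) - (-p : ℤ)| * (q * L ^ ε)) := by gcongr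
        _ = _ := by ring
  have htend : Tendsto (fun n : ℕ => slope x (n + 1)) atTop atTop := by
    refine tendsto_atTop_mono (f := fun n : ℕ => a * (n : ℝ)) (fun n => ?_)
      (tendsto_natCast_atTop_atTop.const_mul_atTop ha)
    have := mul_le_slope x (n + 1)
    push_cast at this
    linarith
  -- Once 8 A L^((1+ε)/2) ≤ L, the bound L ≤ 4K + 5(n + 1) yields L ≤ 10(n + 1) ≤ 20n.
  refine ⟨7 * (A * 20 ^ ((1 + ε) / 2)) + 3, ?_⟩
  filter_upwards [htend.eventually (eventually_mul_rpow_le (8 * A)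
    (by linarith : (1 + ε) / 2 < 1)), htend.eventually_ge_atTop 1, eventually_ge_atTop 1]
    with n h1 h2 hn
  obtain ⟨h3, h4⟩ := hbound n h2
  have hn1 : (1 : ℝ) ≤ n := by exact_mod_cast hn
  have h5 : slope x (n + 1) ≤ 20 * n := by linarith
  have h6 : slope x (n + 1) ^ ((1 + ε) / 2) ≤ 20 ^ ((1 + ε) / 2) * (n : ℝ) ^ ((1 + ε) / 2) := by
    rw [← Real.mul_rpow (by norm_num) (by linarith)]
    exact Real.rpow_le_rpow (by linarith) h5 (by linarith)
  have h7 : 1 ≤ (n : ℝ) ^ ((1 + ε) / 2) := Real.one_le_rpow hn1 (by linarith)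
  calc |(forwardSum x n : ℝ)| ≤ 7 * (A * slope x (n + 1) ^ ((1 + ε) / 2)) + 3 := h3
    _ ≤ 7 * (A * (20 ^ ((1 + ε) / 2) * (n : ℝ) ^ ((1 + ε) / 2)))
        + 3 * (n : ℝ) ^ ((1 + ε) / 2) := by gcongr; linarith
    _ = _ := by ring

/-! ### One-sided approximation and the lower bound -/

/-- One-sided Dirichlet approximation. -/
theorem exists_one_sided_approx {s : ℝ} (hs : Irrational s) (N : ℕ) :
    ∃ p q : ℤ, (N : ℤ) ≤ q ∧ 0 < q ∧ 0 < q * s - p ∧ (q * s - p) * q < 1 := by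
  -- The induction carries a unimodular pair of fractions around s, as in the continued fraction
  -- algorithm: each error is reduced by multiples of the other in turn.
  suffices H : ∃ p q p' q' : ℤ, (N : ℤ) ≤ q ∧ 0 < q ∧ 0 < q' ∧ 0 < q * s - p ∧ 0 < p' - q' * s ∧
      p' * q - p * q' = 1 ∧ p' - q' * s < q * s - p ∧ (q * s - p) * q < 1 by
    obtain ⟨p, q, _, _, h1, h2, -, h3, -, -, -, h4⟩ := H
    exact ⟨p, q, h1, h2, h3, h4⟩
  have hne : ∀ p q : ℤ, 0 < q → (q : ℝ) * s - p ≠ 0 := fun p q hq h => by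
    refine hs ⟨p / q, ?_⟩
    have : (q : ℝ) ≠ 0 := by exact_mod_cast hq.ne'
    push_cast
    field_simp
    linarith
  -- the upper vector is replaced by its last sum with multiples of the lower one
  have upper : ∀ p q p' q' : ℤ, 0 < q → 0 ≤ q' → 0 < q * s - p → 0 < p' - q' * s →
      p' * q - p * q' = 1 → q * s - p < p' - q' * s →
      ∃ p'' q'' : ℤ, 0 < q'' ∧ 0 < p'' - q'' * s ∧ p'' * q - p * q'' = 1 ∧
        p'' - q'' * s < q * s - p ∧ (q * s - p) * q < 1 := by
    intro p q p' q' hq hq' hx hx' hdet hlt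
    set m : ℤ := ⌊(p' - q' * s) / (q * s - p)⌋ with hm
    have hm1 : 1 ≤ m := by
      rw [hm, Int.le_floor, Int.cast_one, one_le_div hx]
      exact hlt.le
    have hml : m * (q * s - p) ≤ p' - q' * s := (le_div_iff₀ hx).1 (Int.floor_le _)
    have hmu : p' - q' * s < (m + 1) * (q * s - p) := (div_lt_iff₀ hx).1 (Int.lt_floor_add_one _)
    have hq'' : q ≤ q' + m * q := by nlinarith
    have hdet' : (p' + m * p) * q - p * (q' + m * q) = 1 := by linarith
    have hn := hne (p' + m * p) (q' + m * q) (by linarith)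
    have hpos : 0 < ((p' + m * p : ℤ) : ℝ) - ((q' + m * q : ℤ) : ℝ) * s := by
      refine lt_of_le_of_ne ?_ fun h => hn (by linarith)
      push_cast
      linarith
    refine ⟨p' + m * p, q' + m * q, by linarith, hpos, hdet', ?_, ?_⟩
    · push_cast
      linarith
    -- The determinant is q times the upper error plus q'' times the lower error, so q'' ≥ q bounds
    -- q times the lower error by 1.
    · have h1 : ((p' + m * p : ℤ) : ℝ) * q - p * ((q' + m * q : ℤ) : ℝ) = 1 := by
        exact_mod_cast hdet'
      have h2 : (q : ℝ) ≤ ((q' + m * q : ℤ) : ℝ) := by exact_mod_cast hq''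
      have h3 : (0 : ℝ) < q := by exact_mod_cast hq
      nlinarith [mul_pos hpos h3]
  induction N with
  | zero =>
    have h0 : (0 : ℝ) < Int.fract s := by
      refine lt_of_le_of_ne (Int.fract_nonneg s) fun h => ?_
      have := hne ⌊s⌋ 1 one_pos
      rw [Int.fract] at h
      push_cast at this
      exact this (by linarith)
    have h1 := Int.fract_lt_one s
    rw [Int.fract] at h0 h1
    obtain ⟨p', q', h2, h3, h4, h5, h6⟩ := upper ⌊s⌋ 1 1 0 one_pos le_rfl (by simpa using h0)
      (by simp) (by simp) (by simpa using h1)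
    exact ⟨⌊s⌋, 1, p', q', by simp, one_pos, h2, by simpa using h0, h3, h4, h5, h6⟩
  | succ N ih =>
    obtain ⟨p, q, p', q', h1, h2, h3, h4, h5, h6, h7, -⟩ := ih
    set m : ℤ := ⌊(q * s - p) / (p' - q' * s)⌋ with hm
    have hm1 : 1 ≤ m := by
      rw [hm, Int.le_floor, Int.cast_one, one_le_div h5]
      exact h7.le
    have hml : m * (p' - q' * s) ≤ q * s - p := (le_div_iff₀ h5).1 (Int.floor_le _)
    have hmu : q * s - p < (m + 1) * (p' - q' * s) := (div_lt_iff₀ h5).1 (Int.lt_floor_add_one _)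
    have hq : q + 1 ≤ q + m * q' := by nlinarith
    have hpos : 0 < ((q + m * q' : ℤ) : ℝ) * s - ((p + m * p' : ℤ) : ℝ) := by
      refine lt_of_le_of_ne ?_ (hne _ _ (by linarith)).symm
      push_cast
      linarith
    have hdet : p' * (q + m * q') - (p + m * p') * q' = 1 := by linarith
    obtain ⟨p'', q'', g1, g2, g3, g4, g5⟩ := upper (p + m * p') (q + m * q') p' q' (by linarith)
      h3.le hpos h5 hdet (by push_cast; linarith)
    exact ⟨p + m * p', q + m * q', p'', q'', by push_cast; linarith, by linarith, g1, hpos, g2,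
      g3, g4, g5⟩

/-- The lower bound for the growth of the forward partial sums. -/
theorem forwardSum_lower (x : triangle) (hs : Irrational (x.1.2 / x.1.1)) :
    ∃ᶠ n : ℕ in atTop, Real.sqrt (x.1.1 * n) ≤ 2 * |(forwardSum x n : ℝ)| + 3 := by
  have ha : 0 < x.1.1 := x.2.1
  have ha1 : x.1.1 ≤ 1 := x.2.2.1
  rw [frequently_atTop]
  intro N
  -- Taking q above this slope places the jump after time N + 1; the additional 2 makes its form at
  -- most 1/2.
  obtain ⟨Q, hQ⟩ := exists_nat_gt (slope x (N + 1))
  obtain ⟨p, q, hqQ, hq, hpos, hlt⟩ := exists_one_sided_approx hs (Q + 2)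
  set a := x.1.1
  set b := x.1.2
  have hq0 : (0 : ℝ) < q := by exact_mod_cast hq
  have hq2 : (Q : ℝ) + 2 ≤ q := by exact_mod_cast hqQ
  have hform : form a b (-p, q) = a * (q * (b / a) - p) := by
    simp only [form]
    push_cast
    field_simp
    ring
  have hfpos : 0 < form a b (-p, q) := by rw [hform]; positivity
  have hfq : form a b (-p, q) * q < 1 := by
    rw [hform]
    nlinarith [mul_pos hpos hq0]
  have hQ0 : (0 : ℝ) ≤ Q := by positivity
  have hfhalf : form a b (-p, q) ≤ 1 / 2 := by nlinarith
  obtain ⟨j, hj, hsl⟩ := exists_orbit_le x (v := (-p, q)) hfpos (by linarith) hq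
  change orbit x j ≤ form a b (-p, q) at hj
  change slope x j = q / form a b (-p, q) at hsl
  set y := form a b (-p, q) with hy
  have hjN : N + 1 < j := by
    refine (strictMono_slope x).lt_iff_lt.1 (hQ.trans_le ?_)
    rw [hsl, le_div_iff₀ hfpos]
    nlinarith
  obtain ⟨i, rfl⟩ : ∃ i, j = i + 1 := ⟨j - 1, by omega⟩
  have hx := orbit_pos x (i + 1)
  -- Both neighbours of x_{i+1} exceed 1 - x_{i+1} ≥ 1/2, so k x_{i+1} is at least 1.
  have hk : 1 / y ≤ orbitIndex x i := by
    have h1 := orbit_add_two x i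
    have h2 := one_lt_orbit_add x i
    have h3 := one_lt_orbit_add x (i + 1)
    have h4 : 1 ≤ orbitIndex x i * orbit x (i + 1) := by linarith
    have h5 : (0 : ℝ) ≤ orbitIndex x i := by
      by_contra! h
      nlinarith
    rw [div_le_iff₀ hfpos]
    nlinarith
  -- The slope q / y is at most 1 / y² and at least a times the time.
  have hsqrt : Real.sqrt (a * ((i + 1 : ℕ) : ℝ)) ≤ 1 / y := by
    refine Real.sqrt_le_iff.2 ⟨by positivity, (mul_le_slope x (i + 1)).trans ?_⟩
    rw [hsl, div_pow, one_pow, div_le_div_iff₀ hfpos (by positivity)]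
    nlinarith
  have hstep : (forwardSum x (i + 1) : ℝ) = forwardSum x i + (orbitIndex x i - 3) := by
    exact_mod_cast forwardSum_succ x i
  have hmono : Real.sqrt (a * i) ≤ Real.sqrt (a * ((i + 1 : ℕ) : ℝ)) := by
    refine Real.sqrt_le_sqrt ?_
    push_cast
    nlinarith
  have h1 := le_abs_self (forwardSum x (i + 1) : ℝ)
  have h2 := neg_abs_le (forwardSum x i : ℝ)
  rcases le_total |(forwardSum x i : ℝ)| |(forwardSum x (i + 1) : ℝ)| with h | h
  · exact ⟨i + 1, by omega, by linarith⟩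
  · exact ⟨i, by omega, by linarith⟩

/-! ### Logarithmic speed -/

theorem logSpeed_eq_half {f : ℕ → ℤ} {c : ℝ} (hc : 0 < c)
    (hU : ∀ ε : ℝ, 0 < ε → ε < 1 →
      ∃ C : ℝ, ∀ᶠ n : ℕ in atTop, |(f n : ℝ)| ≤ C * (n : ℝ) ^ ((1 + ε) / 2))
    (hLo : ∃ᶠ n : ℕ in atTop, Real.sqrt (c * n) ≤ 2 * |(f n : ℝ)| + 3) :
    logSpeed f = ((1 / 2 : ℝ) : EReal) := by
  have hlog : ∀ᶠ n : ℕ in atTop, 0 < Real.log n := by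
    filter_upwards [eventually_gt_atTop 1] with n hn
    exact Real.log_pos (by exact_mod_cast hn)
  apply le_antisymm
  · rw [← EReal.le_of_forall_lt_iff_le]
    intro r hr
    have hr : 1 / 2 < r := by exact_mod_cast hr
    refine limsup_le_of_le (by isBoundedDefault) ?_
    obtain ⟨ε, hε, hεr⟩ : ∃ ε, 0 < ε ∧ ε < min 1 (2 * r - 1) :=
      exists_between (lt_min one_pos (by linarith))
    obtain ⟨C, hC⟩ := hU ε hε (hεr.trans_le (min_le_left _ _))
    have hδ : (1 + ε) / 2 / r < 1 := by
      rw [div_lt_one (by linarith)]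
      linarith [hεr.trans_le (min_le_right _ _)]
    have ht := (tendsto_rpow_atTop (by linarith : 0 < r)).comp
      (tendsto_natCast_atTop_atTop (R := ℝ))
    filter_upwards [hC, ht.eventually (eventually_mul_rpow_le C hδ), hlog,
      eventually_gt_atTop 0] with n h1 h2 h3 h4
    have hn : (0 : ℝ) < n := by exact_mod_cast h4
    rw [Function.comp_apply, ← Real.rpow_mul hn.le, mul_div_cancel₀ _ (by linarith)] at h2
    rw [EReal.coe_le_coe_iff, div_le_iff₀ h3]
    -- At zeros of f the convention `Real.log 0 = 0` leaves only 0 ≤ r log n.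
    rcases eq_or_ne (f n) 0 with h0 | h0
    · rw [h0, Int.cast_zero, abs_zero, Real.log_zero]
      nlinarith
    · rw [← Real.log_rpow hn]
      exact Real.log_le_log (by positivity) (h1.trans h2)
  · rw [← EReal.ge_of_forall_gt_iff_ge]
    intro r hr
    have hr : r < 1 / 2 := by exact_mod_cast hr
    refine le_limsup_of_frequently_le' ?_
    obtain ⟨t, ht, ht2⟩ : ∃ t, max 0 r < t ∧ t < 1 / 2 :=
      exists_between (max_lt (by norm_num) hr)
    have ht0 : 0 < t := (le_max_left _ _).trans_lt ht
    have hsq := (tendsto_rpow_atTop (by norm_num : (0 : ℝ) < 1 / 2)).comp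
      (tendsto_natCast_atTop_atTop (R := ℝ))
    -- The factor 5 gives 5 n^t ≤ 2|f n| + 3, hence n^t ≤ |f n| because n^t ≥ 1.
    refine (hLo.and_eventually ((hsq.eventually (eventually_mul_rpow_le (5 / Real.sqrt c)
      (by linarith : 2 * t < 1))).and (hlog.and (eventually_gt_atTop 0)))).mono ?_
    rintro n ⟨h1, h2, h3, h4⟩
    have hn : (1 : ℝ) ≤ n := by exact_mod_cast h4
    have hn0 : (0 : ℝ) < n := by linarith
    have hsc : 0 < Real.sqrt c := Real.sqrt_pos.2 hc
    rw [Function.comp_apply, ← Real.rpow_mul hn0.le, ← Real.sqrt_eq_rpow,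
      show (1 : ℝ) / 2 * (2 * t) = t by ring, div_mul_eq_mul_div, div_le_iff₀ hsc] at h2
    rw [Real.sqrt_mul hc.le] at h1
    have h5 : 1 ≤ (n : ℝ) ^ t := Real.one_le_rpow hn ht0.le
    have h6 : (n : ℝ) ^ t ≤ |(f n : ℝ)| := by linarith
    rw [EReal.coe_le_coe_iff, le_div_iff₀ h3]
    calc r * Real.log n ≤ t * Real.log n := by
          have := (le_max_right _ _).trans_lt ht
          gcongr
      _ = Real.log ((n : ℝ) ^ t) := (Real.log_rpow hn0 t).symm
      _ ≤ _ := Real.log_le_log (by linarith) h6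

theorem logSpeed_forwardSum (x : triangle) (hs : Irrational (x.1.2 / x.1.1))
    (hL : ∀ p > (2 : ℝ), ¬ LiouvilleWith p (x.1.2 / x.1.1)) :
    logSpeed (forwardSum x) = ((1 / 2 : ℝ) : EReal) :=
  logSpeed_eq_half x.2.1 (fun _ h0 h1 => forwardSum_upper x hs hL h0 h1) (forwardSum_lower x hs)

theorem logSpeed_backwardSum (x : triangle) (hs : Irrational (x.1.1 / x.1.2))
    (hL : ∀ p > (2 : ℝ), ¬ LiouvilleWith p (x.1.1 / x.1.2)) :
    logSpeed (backwardSum x) = ((1 / 2 : ℝ) : EReal) := by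
  have hb : 0 < x.1.2 := x.2.2.2.1
  refine logSpeed_eq_half hb (fun ε h0 h1 => ?_) ?_
  · obtain ⟨C, hC⟩ := forwardSum_upper (flip x) hs hL h0 h1
    refine ⟨|C| * 2 ^ ((1 + ε) / 2), ?_⟩
    filter_upwards [(tendsto_add_atTop_nat 1).eventually hC, eventually_ge_atTop 1] with n hn h2
    have hn1 : (1 : ℝ) ≤ n := by exact_mod_cast h2
    rw [backwardSum_eq, mul_assoc, ← Real.mul_rpow (by norm_num) (by linarith)]
    refine hn.trans ?_
    push_cast
    gcongr
    · exact le_abs_self C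
    · linarith
  · have h := (forwardSum_lower (flip x) hs).and_eventually (eventually_ge_atTop 1)
    rw [frequently_atTop] at h ⊢
    intro N
    obtain ⟨n, hn, h2, h3⟩ := h (N + 1)
    obtain ⟨m, rfl⟩ : ∃ m, n = m + 1 := ⟨n - 1, by omega⟩
    refine ⟨m, by omega, ?_⟩
    rw [backwardSum_eq]
    refine le_trans (Real.sqrt_le_sqrt ?_) h2
    change x.1.2 * (m : ℝ) ≤ x.1.2 * ((m + 1 : ℕ) : ℝ)
    push_cast
    gcongr
    linarith

/-! ### The three exponents -/

theorem infinite_approx_below {s : ℝ} (hs : Irrational s) :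
    {r : ℚ | 0 < s - (r : ℝ) ∧ s - (r : ℝ) < 1 / (r.den : ℝ) ^ (2 : ℝ)}.Infinite := by
  have key : ∀ N : ℕ, 1 ≤ N →
      ∃ r : ℚ, (0 < s - (r : ℝ) ∧ s - (r : ℝ) < 1 / (r.den : ℝ) ^ (2 : ℝ)) ∧
        s - (r : ℝ) < 1 / N := by
    intro N hN
    obtain ⟨p, q, hqN, hq, hpos, hlt⟩ := exists_one_sided_approx hs N
    have hq0 : (0 : ℝ) < q := by exact_mod_cast hq
    have hN1 : (1 : ℝ) ≤ N := by exact_mod_cast hN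
    have hqN' : (N : ℝ) ≤ q := by exact_mod_cast hqN
    have hr : s - ((p / q : ℚ) : ℝ) = (q * s - p) / q := by
      push_cast
      field_simp
    have hden : (((p / q : ℚ).den : ℝ)) ≤ q := by
      have := Int.le_of_dvd hq (Rat.den_dvd p q)
      rw [← Rat.divInt_eq_div]
      exact_mod_cast this
    have hden0 : (0 : ℝ) < (p / q : ℚ).den := by exact_mod_cast (p / q : ℚ).pos
    refine ⟨p / q, ⟨?_, ?_⟩, ?_⟩
    · rw [hr]; positivity
    · rw [hr, Real.rpow_two, div_lt_div_iff₀ hq0 (by positivity)]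
      have : ((p / q : ℚ).den : ℝ) ^ 2 ≤ q ^ 2 := by gcongr
      nlinarith
    · rw [hr, div_lt_div_iff₀ hq0 (by positivity)]
      nlinarith
  -- A finite set would contain a closest approximation, whereas `key` supplies approximations
  -- arbitrarily close to s.
  intro hfin
  obtain ⟨r₁, hr₁, -⟩ := key 1 le_rfl
  obtain ⟨r₀, hr₀, hmin⟩ := Set.exists_min_image _ (fun r : ℚ => s - (r : ℝ)) hfin ⟨r₁, hr₁⟩
  obtain ⟨N, hN⟩ := exists_nat_one_div_lt hr₀.1
  obtain ⟨r, hr, hrN⟩ := key (N + 1) (by omega)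
  have := hmin r hr
  push_cast at hrN
  linarith

theorem infinite_approx_above {s : ℝ} (hs : Irrational s) :
    {r : ℚ | 0 < (r : ℝ) - s ∧ (r : ℝ) - s < 1 / (r.den : ℝ) ^ (2 : ℝ)}.Infinite := by
  refine ((infinite_approx_below hs.neg).image neg_injective.injOn).mono ?_
  rintro _ ⟨r, ⟨h1, h2⟩, rfl⟩
  simp only [Set.mem_ofPred_eq, Rat.cast_neg, Rat.neg_den]
  constructor
  · linarith
  · linarith

/-- Denominators are bounded by the failure of the Liouville condition, and then numerators because
v > 0 forces |s - r| < 1. -/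
theorem finite_approx {s v : ℝ} (hs : Irrational s) (hv : 0 < v) (hL : ¬ LiouvilleWith v s) :
    {r : ℚ | |s - (r : ℝ)| < 1 / (r.den : ℝ) ^ v}.Finite := by
  obtain ⟨N, hN⟩ := eventually_atTop.1 (eventually_le_abs_sub_div hs hL)
  obtain ⟨B, hB⟩ := exists_nat_gt ((|s| + 1) * N)
  refine (((Set.finite_Icc (-(B : ℤ)) B).prod (Set.finite_Iio N)).image
    fun z : ℤ × ℕ => (z.1 / z.2 : ℚ)).subset ?_
  intro r hr
  have hr : |s - (r : ℝ)| < 1 / (r.den : ℝ) ^ v := hr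
  have hd : (1 : ℝ) ≤ r.den := by exact_mod_cast r.pos
  have hrd : (r : ℝ) = r.num / r.den := Rat.cast_def r
  have hlt : r.den < N := by
    by_contra! h
    have := hN r.den h r.num
    rw [← hrd] at this
    linarith
  have h1 : |s - (r : ℝ)| < 1 := by
    refine hr.trans_le ?_
    rw [div_le_one (by positivity)]
    exact Real.one_le_rpow hd hv.le
  have h2 : |(r : ℝ)| ≤ |s| + 1 := by
    have := abs_sub_abs_le_abs_sub (r : ℝ) s
    rw [abs_sub_comm] at this
    linarith
  have h3 : |(r.num : ℝ)| ≤ B := by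
    have h4 : (r.num : ℝ) = r * r.den := by
      rw [hrd]
      field_simp
    have h5 : (r.den : ℝ) ≤ N := by exact_mod_cast hlt.le
    rw [h4, abs_mul, Nat.abs_cast]
    refine le_trans ?_ hB.le
    gcongr
  refine ⟨(r.num, r.den), ⟨?_, hlt⟩, Rat.num_div_den r⟩
  rw [abs_le] at h3
  constructor
  · exact_mod_cast h3.1
  · exact_mod_cast h3.2

theorem exponents_eq_two {s : ℝ} (hs : Irrational s) (hL : ∀ p > (2 : ℝ), ¬ LiouvilleWith p s) :
    exponent s = 2 ∧ evenExponent s = 2 ∧ oddExponent s = 2 := by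
  have hle : exponent s ≤ 2 := by
    refine sSup_le ?_
    rintro _ ⟨v, hv, rfl⟩
    by_contra! h
    have h : 2 < v := EReal.coe_lt_coe_iff.1 h
    exact hv (finite_approx hs (by linarith) (hL v h))
  have heven : evenExponent s ≤ exponent s := by
    refine sSup_le_sSup (Set.image_mono fun v hv => hv.mono ?_)
    rintro r ⟨h1, h2⟩
    rw [Set.mem_ofPred_eq, abs_sub_comm, abs_of_pos h1]
    exact h2
  have hodd : oddExponent s ≤ exponent s := by
    refine sSup_le_sSup (Set.image_mono fun v hv => hv.mono ?_)
    rintro r ⟨h1, h2⟩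
    rw [Set.mem_ofPred_eq, abs_of_pos h1]
    exact h2
  have heven' : 2 ≤ evenExponent s := le_sSup ⟨2, infinite_approx_above hs, rfl⟩
  have hodd' : 2 ≤ oddExponent s := le_sSup ⟨2, infinite_approx_below hs, rfl⟩
  exact ⟨le_antisymm hle (heven'.trans heven), le_antisymm (heven.trans hle) heven',
    le_antisymm (hodd.trans hle) hodd'⟩

/-! ### Passage to almost every point of the plane -/

/-- A property of almost every real number holds for the quotient of the coordinates of almost
every point of the plane. -/
theorem ae_div_of_ae {P : ℝ → Prop} (h : ∀ᵐ s : ℝ, P s) :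
    ∀ᵐ x : ℝ × ℝ ∂volume, x.1 ≠ 0 → P (x.2 / x.1) := by
  -- P need not be measurable, so its exceptional set is replaced by a measurable null hull before
  -- Fubini is applied.
  set N := toMeasurable volume {s : ℝ | ¬ P s} with hN
  have hNm : MeasurableSet N := measurableSet_toMeasurable _ _
  have hN0 : volume N = 0 := by rw [hN, measure_toMeasurable]; exact h
  have hA : MeasurableSet {x : ℝ × ℝ | x.1 ≠ 0 ∧ x.2 / x.1 ∈ N} :=
    (measurableSet_eq_fun measurable_fst measurable_const).compl.inter
      ((measurable_snd.div measurable_fst) hNm)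
  have hA0 : volume {x : ℝ × ℝ | x.1 ≠ 0 ∧ x.2 / x.1 ∈ N} = 0 := by
    rw [Measure.volume_eq_prod, Measure.measure_prod_null hA]
    refine Eventually.of_forall fun a => ?_
    rcases eq_or_ne a 0 with rfl | ha
    · simp
    · refine measure_mono_null (t := (fun b => a⁻¹ * b) ⁻¹' N) ?_ ?_
      · rintro b ⟨-, hb⟩
        simpa [div_eq_inv_mul] using hb
      · rw [Real.volume_preimage_mul_left (inv_ne_zero ha), hN0, mul_zero]
  refine measure_mono_null ?_ hA0
  intro x hx
  simp only [Set.mem_compl_iff, Set.mem_ofPred_eq, Classical.not_imp] at hx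
  exact ⟨hx.1, subset_toMeasurable _ _ hx.2⟩

theorem ae_irrational_div_and_not_liouvilleWith :
    ∀ᵐ x : ℝ × ℝ ∂volume, x.1 ≠ 0 → Irrational (x.2 / x.1) ∧
      ∀ p > (2 : ℝ), ¬ LiouvilleWith p (x.2 / x.1) := by
  refine ae_div_of_ae (P := fun s => Irrational s ∧ ∀ p > (2 : ℝ), ¬ LiouvilleWith p s) ?_
  have h : ∀ᵐ s : ℝ, Irrational s := (Set.countable_range ((↑) : ℚ → ℝ)).ae_notMem volume
  exact h.and ae_not_liouvilleWith

end BCZ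

end

/-- For Lebesgue-almost every point `(a, b)` of the BCZ triangle, `b / a` is irrational, its
Diophantine exponent and its even and odd Diophantine exponents are `2`, and both
`limsup log |f_n| / log n` and `limsup log |f_{-n}| / log n` are `1 / 2`. -/
theorem corollary1p5 :
    ∀ᵐ x : ℝ × ℝ ∂volume, ∀ hx : x ∈ BCZ.triangle,
      Irrational (x.2 / x.1) ∧
      BCZ.exponent (x.2 / x.1) = 2 ∧
      BCZ.evenExponent (x.2 / x.1) = 2 ∧
      BCZ.oddExponent (x.2 / x.1) = 2 ∧
      BCZ.logSpeed (BCZ.forwardSum ⟨x, hx⟩) = ((1 / 2 : ℝ) : EReal) ∧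
      BCZ.logSpeed (BCZ.backwardSum ⟨x, hx⟩) = ((1 / 2 : ℝ) : EReal) := by
  have h := BCZ.ae_irrational_div_and_not_liouvilleWith
  -- The backward sums depend on the reciprocal ratio; the coordinate swap preserves Lebesgue
  -- measure.
  have hswap : ∀ᵐ x : ℝ × ℝ ∂volume, x.2 ≠ 0 → Irrational (x.1 / x.2) ∧
      ∀ p > (2 : ℝ), ¬ LiouvilleWith p (x.1 / x.2) :=
    (Measure.measurePreserving_swap (μ := (volume : Measure ℝ))
      (ν := (volume : Measure ℝ))).quasiMeasurePreserving.ae h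
  filter_upwards [h, hswap] with x h1 h2 hx
  obtain ⟨hirr, hL⟩ := h1 hx.1.ne'
  obtain ⟨hirr', hL'⟩ := h2 hx.2.2.1.ne'
  obtain ⟨he, he1, he2⟩ := BCZ.exponents_eq_two hirr hL
  exact ⟨hirr, he, he1, he2, BCZ.logSpeed_forwardSum ⟨x, hx⟩ hirr hL,
    BCZ.logSpeed_backwardSum ⟨x, hx⟩ hirr' hL'⟩
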